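/- **Definitions.** A \emph{compactum} is a compact metric space; a \emph{continuum} is a (non-empty) connected compactum. A continuum is \emph{decomposable} if it is the union of two proper subcontinua, and \emph{indecomposable} otherwise; a compactum $X$ (not necessarily connected) is \emph{hereditarily indecomposable} if every non-degenerate subcontinuum of $X$ is indecomposable. An \emph{arc} is a space homeomorphic to $[0,1]$. A \emph{graph} is a (metric, not necessarily connected) space which is the union of finitely many arcs, any two of which intersect at most in endpoints of both. A \emph{map} is a continuous function. A set $M$ \emph{separates} $A$ from $B$ in a space $Y$ if $Y \smallsetminus M = R_0 \cup R_1$, where $R_0$ and $R_1$ are disjoint and open in $Y \smallsetminus M$, $A \subseteq R_0$ and $B \subseteq R_1$. For maps $f,g \colon X \to G$, $d_{\sup}(f,g) = \sup\{d(f(x),g(x)) : x \in X\}$, where $d$ is the metric of $G$ (and $d_{\sup}=0$ if $X=\emptyset$). **Theorem.** A compactum $X$ is hereditarily indecomposable if and only if for every map $f \colon X \to G$ to a graph $G$, for every set $M \subseteq G \times (0,1)$ which separates $G \times \{0\}$ from $G \times \{1\}$ in $G \times [0,1]$, for every open set $U \subseteq G \times [0,1]$ with $M \subseteq U$, and for every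 $\varepsilon > 0$, there exists a map $h \colon X \to U$ such that $d_{\sup}(f, \pi_1 \circ h) < \varepsilon$, where $\pi_1 \colon G \times [0,1] \to G$ is the first coordinate projection. -/

import Mathlib

open Set

universe u v

/-- A subset of a topological space is a subcontinuum if it is compact, connected and non-empty.
(In a metric space these are exactly the subsets that are continua.) -/
def IsSubcontinuum {X : Type*} [TopologicalSpace X] (K : Set X) : Prop :=
  IsCompact K ∧ IsConnected K

/-- A continuum `K` is decomposable if it is the union of two proper subcontinua. -/
def IsDecomposable {X : Type*} [TopologicalSpace X] (K : Set X) : Prop :=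
  ∃ A B : Set X, IsSubcontinuum A ∧ IsSubcontinuum B ∧ A ⊂ K ∧ B ⊂ K ∧ A ∪ B = K

/-- A space is hereditarily indecomposable if each of its non-degenerate subcontinua is
indecomposable.  The space itself need not be connected. -/
def HereditarilyIndecomposable (X : Type*) [TopologicalSpace X] : Prop :=
  ∀ K : Set X, IsSubcontinuum K → K.Nontrivial → ¬ IsDecomposable K

/-- A graph is a space which is the union of finitely many arcs (each parametrized here by an
embedding of `[0,1]`), any two of which meet at most in points that are endpoints of both.
Graphs need not be connected. -/
def IsGraph (G : Type*) [TopologicalSpace G] : Prop :=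
  ∃ (n : ℕ) (e : Fin n → unitInterval → G),
    (∀ i, Topology.IsEmbedding (e i)) ∧
    (⋃ i, range (e i)) = univ ∧
    ∀ i j, i ≠ j → ∀ s t : unitInterval, e i s = e j t →
      (s = 0 ∨ s = 1) ∧ (t = 0 ∨ t = 1)

/-- `M` separates `A` from `B` in `Y` if the complement of `M` is the union of two disjoint sets
`R₀ ⊇ A` and `R₁ ⊇ B`, both open in the complement of `M`; here `R₀ = V₀ \ M` and `R₁ = V₁ \ M`
with `V₀`, `V₁` open in `Y`.  The set `M` need not be closed. -/
def Separates {Y : Type*} [TopologicalSpace Y] (M A B : Set Y) : Prop :=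
  ∃ V₀ V₁ : Set Y, IsOpen V₀ ∧ IsOpen V₁ ∧
    (V₀ \ M) ∪ (V₁ \ M) = Mᶜ ∧ Disjoint (V₀ \ M) (V₁ \ M) ∧ A ⊆ V₀ \ M ∧ B ⊆ V₁ \ M

/-!
A hereditarily indecomposable compactum `X` has a very rigid structure of subcontinua: two of them
that meet are nested.  Through clopen neighbourhoods of unions of components this becomes a fold
property (`HereditarilyIndecomposable.exists_fold`): any two disjoint closed sets `A`, `B` are
contained in the two outer ones of three consecutive closed layers, where the cut next to the layer
containing `A` lies near `B`, and the cut next to the layer containing `B` lies near `A`.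

To lift a map `f : X → G` into a neighbourhood of a separator, pull the separation back to the
cylinder over `X` and choose a function `Φ` on this cylinder that is `0` on the bottom and on one
side of the neighbourhood and `1` on the top and on the other side.  It suffices to find a
continuous height `τ` with `0 < Φ (x, τ x) < 1` (`HereditarilyIndecomposable.exists_height`); then
`x ↦ (f x, τ x)` is a lift whose first coordinate is exactly `f`.  The cylinder is sliced at finitely
many levels.  The sets where `Φ` exceeds `1 / 2` on a slice, and where it exceeds `5 / 8` on two
consecutive slices, form a staircase, that is, a zigzag of inclusions from the empty set to `X`.  An
index at which the membership of `x` changes gives a level where `Φ` takes an intermediate value,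
and the point is to choose this index so that it jumps by one at a time, and only close to the
frontiers of the sets of the staircase.
This is `HereditarilyIndecomposable.exists_isStaircaseSection`, proved by induction on the height of
the staircase: a section of a staircase is glued along a fold from three sections of staircases
that are shorter by two steps.  A partition of unity replaces the index by a continuous height
(`exists_continuous_of_frontier_subset`).

Conversely, if a subcontinuum of `X` is the union of proper subcontinua `A` and `B`, map `X` to an
arc so that `A` goes to the first half and reaches the first endpoint, and `B` goes to the second
half and reaches the second endpoint.  In the square over the arc there is an S-shaped open
separator along which a connected set over the first half that reaches the first endpoint has to
stay in the lower branch, and one over the second half that reaches the second endpoint in the upper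
branch.  Hence the lifts of `A` and `B` are disjoint, although `A` meets `B`
(`not_isDecomposable_of_exists_lift`).
-/

/-! ### Components of closed sets and folds -/

/-- The union `P` of the components of a closed set `Z` that meet a closed subset `S` is closed, and
it has relatively clopen neighbourhoods in `Z` inside every open set containing it. -/
theorem exists_componentHull {X : Type*} [TopologicalSpace X] [CompactSpace X] [T2Space X]
    {Z S : Set X} (hZ : IsClosed Z) (hS : IsClosed S) (hSZ : S ⊆ Z) :
    ∃ P : Set X, IsClosed P ∧
      (∀ x ∈ P, ∃ C : Set X, IsSubcontinuum C ∧ C ⊆ Z ∧ x ∈ C ∧ (C ∩ S).Nonempty) ∧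
      ∀ G : Set X, IsOpen G → P ⊆ G →
        ∃ O ⊆ Z, IsClosed O ∧ IsClosed (Z \ O) ∧ S ⊆ O ∧ O ⊆ G := by
  have : CompactSpace Z := isCompact_iff_compactSpace.1 hZ.isCompact
  let π : Z → ConnectedComponents Z := (↑)
  have hπ : Continuous π := ConnectedComponents.continuous_coe
  have hcl : IsClosedMap π := hπ.isClosedMap
  have hval : Topology.IsClosedEmbedding (Subtype.val : Z → X) := hZ.isClosedEmbedding_subtypeVal
  let S₀ : Set Z := Subtype.val ⁻¹' S
  have hS₀ : IsClosed S₀ := hS.preimage continuous_subtype_val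
  refine ⟨Subtype.val '' (π ⁻¹' (π '' S₀)),
    hval.isClosedMap _ ((hcl _ hS₀).preimage hπ), ?_, ?_⟩
  · rintro _ ⟨x, ⟨y, hy, hxy⟩, rfl⟩
    have hxy' : connectedComponent y = connectedComponent x := ConnectedComponents.coe_eq_coe.1 hxy
    refine ⟨Subtype.val '' connectedComponent x,
      ⟨isClosed_connectedComponent.isCompact.image continuous_subtype_val,
        isConnected_connectedComponent.image _ continuous_subtype_val.continuousOn⟩,
      Subtype.coe_image_subset _ _, ⟨x, mem_connectedComponent, rfl⟩, y,
      ⟨y, hxy' ▸ mem_connectedComponent, rfl⟩, hy⟩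
  · intro G hG hPG
    let T : Set Z := (Subtype.val ⁻¹' G)ᶜ
    have hT : IsClosed T := (hG.preimage continuous_subtype_val).isClosed_compl
    obtain ⟨C, hC, h₁, h₂⟩ := exists_clopen_of_closed_subset_open (hcl _ hS₀)
      (hcl _ hT).isOpen_compl (by
        rintro _ ⟨y, hy, rfl⟩ ⟨z, hz, hzy⟩
        exact hz (hPG ⟨z, ⟨y, hy, hzy.symm⟩, rfl⟩))
    have hO := hC.preimage hπ
    refine ⟨Subtype.val '' (π ⁻¹' C), Subtype.coe_image_subset _ _,
      hval.isClosedMap _ hO.1, ?_, ?_, ?_⟩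
    · have : Z \ Subtype.val '' (π ⁻¹' C) = Subtype.val '' (π ⁻¹' C)ᶜ := by
        rw [image_compl_eq_range_sdiff_image Subtype.val_injective, Subtype.range_coe]
      rw [this]
      exact hval.isClosedMap _ hO.compl.1
    · intro x hx
      exact ⟨⟨x, hSZ hx⟩, h₁ ⟨_, hx, rfl⟩, rfl⟩
    · rintro _ ⟨x, hx, rfl⟩
      by_contra hxG
      exact h₂ hx ⟨x, hxG, rfl⟩

/-- In a hereditarily indecomposable space, two subcontinua that meet are nested. -/
theorem HereditarilyIndecomposable.subset_or_subset {X : Type*} [TopologicalSpace X]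
    (hX : HereditarilyIndecomposable X) {C D : Set X} (hC : IsSubcontinuum C)
    (hD : IsSubcontinuum D) (h : (C ∩ D).Nonempty) : C ⊆ D ∨ D ⊆ C := by
  by_contra! hCD
  obtain ⟨p, hpC, hpD⟩ := not_subset.1 hCD.1
  obtain ⟨q, hqD, hqC⟩ := not_subset.1 hCD.2
  refine hX (C ∪ D) ⟨hC.1.union hD.1, hC.2.union h hD.2⟩
    ⟨p, Or.inl hpC, q, Or.inr hqD, fun e => hpD (e ▸ hqD)⟩
    ⟨C, D, hC, hD, ⟨subset_union_left, fun h => hqC (h (Or.inr hqD))⟩,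
      ⟨subset_union_right, fun h => hpD (h (Or.inl hpC))⟩, rfl⟩

/-- A relatively clopen part `O` of the complement of an open set `V` can leave its complement
only through the closure of `V`. -/
theorem inter_closure_compl_subset {X : Type*} [TopologicalSpace X] {V O : Set X}
    (hO : IsClosed (Vᶜ \ O)) : O ∩ closure Oᶜ ⊆ closure V := by
  rintro x ⟨hxO, hx⟩
  by_contra hxV
  obtain ⟨y, ⟨hy₁, hy₂⟩, hyO⟩ := mem_closure_iff.1 hx ((closure V)ᶜ ∩ (Vᶜ \ O)ᶜ)
    (isClosed_closure.isOpen_compl.inter hO.isOpen_compl) ⟨hxV, fun h => h.2 hxO⟩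
  exact hy₂ ⟨fun h => hy₁ (subset_closure h), hyO⟩

/-- The fold property of Krasinkiewicz and Minc: the space is cut into three consecutive closed
layers, the first containing `A` and the last containing `B`, such that the first cut takes place
near `B` and the second one near `A`. -/
theorem HereditarilyIndecomposable.exists_fold {X : Type*} [TopologicalSpace X] [CompactSpace X]
    [T2Space X] (hX : HereditarilyIndecomposable X) {A B WA WB : Set X} (hA : IsClosed A)
    (hB : IsClosed B) (hAB : Disjoint A B) (hWA : IsOpen WA) (hAWA : A ⊆ WA) (hWB : IsOpen WB)
    (hBWB : B ⊆ WB) :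
    ∃ X₀ X₁ X₂ : Set X, IsClosed X₀ ∧ IsClosed X₁ ∧ IsClosed X₂ ∧ X₀ ∪ X₁ ∪ X₂ = univ ∧
      A ⊆ X₀ ∧ B ⊆ X₂ ∧ Disjoint X₀ X₂ ∧ X₀ ∩ X₁ ⊆ WB ∧ X₁ ∩ X₂ ⊆ WA := by
  obtain ⟨U, hU, hAU, hUcl⟩ := normal_exists_closure_subset hA (hWA.inter hB.isOpen_compl)
    (subset_inter hAWA hAB.subset_compl_right)
  obtain ⟨V, hV, hBV, hVcl⟩ := normal_exists_closure_subset hB (hWB.inter hA.isOpen_compl)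
    (subset_inter hBWB hAB.symm.subset_compl_right)
  obtain ⟨P, hP, hPC, hPG⟩ := exists_componentHull hV.isClosed_compl hA
    fun x hx h => (hVcl (subset_closure h)).2 hx
  obtain ⟨Q, hQ, hQC, hQG⟩ := exists_componentHull hU.isClosed_compl hB
    fun x hx h => (hUcl (subset_closure h)).2 hx
  have hPQ : Disjoint P Q := by
    rw [disjoint_left]
    intro x hxP hxQ
    obtain ⟨C, hC, hCV, hxC, a, haC, haA⟩ := hPC x hxP
    obtain ⟨D, hD, hDU, hxD, b, hbD, hbB⟩ := hQC x hxQ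
    rcases hX.subset_or_subset hC hD ⟨x, hxC, hxD⟩ with h | h
    · exact hDU (h haC) (hAU haA)
    · exact hCV (h hbD) (hBV hbB)
  obtain ⟨GP, GQ, hGP, hGQ, hPGP, hQGQ, hG⟩ := normal_separation hP hQ hPQ
  obtain ⟨O, -, hO, hO', hAO, hOG⟩ := hPG GP hGP hPGP
  obtain ⟨O₂, -, hO₂, hO₂', hBO₂, hO₂G⟩ := hQG GQ hGQ hQGQ
  refine ⟨O, closure (O ∪ O₂)ᶜ, O₂, hO, isClosed_closure, hO₂, ?_, hAO, hBO₂,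
    hG.mono hOG hO₂G, ?_, ?_⟩
  · refine eq_univ_of_forall fun x => ?_
    by_cases h : x ∈ O ∪ O₂
    · exact h.elim (fun h => Or.inl (Or.inl h)) Or.inr
    · exact Or.inl (Or.inr (subset_closure h))
  · rintro x ⟨hx, hx'⟩
    exact (hVcl (inter_closure_compl_subset hO'
      ⟨hx, closure_mono (compl_subset_compl.2 subset_union_left) hx'⟩)).1
  · rintro x ⟨hx', hx⟩
    exact (hUcl (inter_closure_compl_subset hO₂'
      ⟨hx, closure_mono (compl_subset_compl.2 subset_union_right) hx'⟩)).1

/-! ### Sections of staircases -/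

/-- A staircase of height `2 * k + 1`: sets `D 0 = ∅, D 1, …, D (2 * k + 1) = univ`, each set of
even index being strictly inside its neighbours.  Parity is expressed through `i % 2`. -/
structure IsStaircase {X : Type*} [TopologicalSpace X] (k : ℕ) (D : ℕ → Set X) : Prop where
  zero : D 0 = ∅
  top : D (2 * k + 1) = univ
  even : ∀ i ≤ 2 * k, i % 2 = 0 → closure (D i) ⊆ interior (D (i + 1))
  odd : ∀ i ≤ 2 * k, i % 2 = 1 → closure (D (i + 1)) ⊆ interior (D i)

/-- A section of a staircase assigns to every point `x` a level `s x` such that exactly one of the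
sets `D (s x)` and `D (s x + 1)` contains `x`, and passes from levels below `i` to levels from `i`
on only inside the prescribed neighbourhood `N i` of the frontier of `D i`. -/
structure IsStaircaseSection {X : Type*} [TopologicalSpace X] (k : ℕ) (D N : ℕ → Set X)
    (s : X → ℕ) : Prop where
  le : ∀ x, s x ≤ 2 * k
  valid : ∀ x, ¬(x ∈ D (s x) ↔ x ∈ D (s x + 1))
  frontier_subset : ∀ i, frontier {x | i ≤ s x} ⊆ N i

section

variable {X : Type*} [TopologicalSpace X]

theorem mem_interior_of_notMem_frontier {S T : Set X} {x : X} (hx : x ∈ closure S)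
    (hf : x ∉ frontier S) (h : S ⊆ T) : x ∈ interior T := by
  by_contra hi
  exact hf ⟨hx, fun h' => hi (interior_mono h h')⟩

theorem IsStaircase.of_even {k : ℕ} {D : ℕ → Set X} (hD : IsStaircase k D) {i : ℕ}
    (hi : i ≤ 2 * k) (h : i % 2 = 0) {x : X} (hx : ¬(x ∈ D i ↔ x ∈ D (i + 1))) :
    x ∉ D i ∧ x ∈ D (i + 1) := by
  have := fun h' : x ∈ D i => interior_subset (hD.even i hi h (subset_closure h'))
  tauto

theorem IsStaircase.of_odd {k : ℕ} {D : ℕ → Set X} (hD : IsStaircase k D) {i : ℕ}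
    (hi : i ≤ 2 * k) (h : i % 2 = 1) {x : X} (hx : ¬(x ∈ D i ↔ x ∈ D (i + 1))) :
    x ∈ D i ∧ x ∉ D (i + 1) := by
  have := fun h' : x ∈ D (i + 1) => interior_subset (hD.odd i hi h (subset_closure h'))
  tauto

/-- The neighbourhoods of the frontiers in a staircase can be shrunk until each of them stays
strictly inside or outside the neighbouring sets. -/
theorem IsStaircase.exists_shrink {k : ℕ} {D N : ℕ → Set X} (hD : IsStaircase k D)
    (hN : ∀ i, IsOpen (N i)) (hDN : ∀ i ≤ 2 * k + 1, frontier (D i) ⊆ N i) :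
    ∃ N' : ℕ → Set X, (∀ i, IsOpen (N' i)) ∧ (∀ i, N' i ⊆ N i) ∧
      (∀ i ≤ 2 * k + 1, frontier (D i) ⊆ N' i) ∧
      (∀ i, i % 2 = 0 → N' i ⊆ interior (D (i - 1)) ∧ N' i ⊆ interior (D (i + 1))) ∧
      (∀ i, i % 2 = 1 → Disjoint (N' i) (closure (D (i - 1))) ∧
        Disjoint (N' i) (closure (D (i + 1)))) := by
  refine ⟨fun i => if i % 2 = 0 then N i ∩ (interior (D (i - 1)) ∩ interior (D (i + 1)))
    else N i ∩ ((closure (D (i - 1)))ᶜ ∩ (closure (D (i + 1)))ᶜ), fun i => ?_, fun i => ?_,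
    fun i hi => ?_, fun i hi => ?_, fun i hi => ?_⟩
  · dsimp only
    split_ifs
    · exact (hN i).inter (isOpen_interior.inter isOpen_interior)
    · exact (hN i).inter (isClosed_closure.isOpen_compl.inter isClosed_closure.isOpen_compl)
  · dsimp only
    split_ifs <;> exact inter_subset_left
  · rcases Nat.eq_zero_or_pos i with rfl | h0
    · simp [hD.zero]
    rcases hi.eq_or_lt with rfl | hi'
    · simp [hD.top]
    obtain ⟨j, rfl⟩ : ∃ j, i = j + 1 := ⟨i - 1, by omega⟩
    intro x hx
    have hxN := hDN _ hi hx
    dsimp only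
    rw [Nat.add_sub_cancel]
    split_ifs with h
    · exact ⟨hxN, hD.odd j (by omega) (by omega) hx.1, hD.even _ (by omega) h hx.1⟩
    · exact ⟨hxN, fun h' => hx.2 (hD.even j (by omega) (by omega) h'),
        fun h' => hx.2 (hD.odd _ (by omega) (by omega) h')⟩
  · dsimp only
    rw [if_pos hi]
    exact ⟨fun x hx => hx.2.1, fun x hx => hx.2.2⟩
  · dsimp only
    rw [if_neg (show ¬i % 2 = 0 by omega)]
    exact ⟨disjoint_left.2 fun x hx => hx.2.1, disjoint_left.2 fun x hx => hx.2.2⟩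

/-- The lower section: a section of the staircase `D 0, …, D (2 * k), univ`. -/
theorem IsStaircase.exists_low {k : ℕ} {D N : ℕ → Set X} (hD : IsStaircase (k + 1) D)
    (hDN : ∀ i ≤ 2 * k + 3, frontier (D i) ⊆ N i)
    (ih : ∀ D' N' : ℕ → Set X, IsStaircase k D' → (∀ i, IsOpen (N' i)) →
      (∀ i ≤ 2 * k + 1, frontier (D' i) ⊆ N' i) → ∃ s, IsStaircaseSection k D' N' s)
    (hN : ∀ i, IsOpen (N i)) :
    ∃ s : X → ℕ, (∀ x, s x ≤ 2 * k) ∧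
      (∀ x, s x < 2 * k → ¬(x ∈ D (s x) ↔ x ∈ D (s x + 1))) ∧
      (∀ x, s x = 2 * k → x ∉ D (2 * k)) ∧
      ∀ i, frontier {x | i ≤ s x} ⊆ N i := by
  let D' : ℕ → Set X := fun i => if i ≤ 2 * k then D i else univ
  have h1 : ∀ i ≤ 2 * k, D' i = D i := fun i hi => if_pos hi
  have h2 : D' (2 * k + 1) = univ := if_neg (by omega)
  have hD' : IsStaircase k D' := by
    refine ⟨by rw [h1 _ (by omega), hD.zero], h2, fun i hi h => ?_, fun i hi h => ?_⟩
    · rw [h1 i hi]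
      rcases hi.eq_or_lt with rfl | hi'
      · simp [h2]
      · rw [h1 _ hi']
        exact hD.even i (by omega) h
    · rw [h1 i hi, h1 _ (by omega)]
      exact hD.odd i (by omega) h
  obtain ⟨s, hs⟩ := ih D' N hD' hN fun i hi => by
    rcases hi.eq_or_lt with rfl | hi'
    · simp [h2]
    · rw [h1 _ (by omega)]
      exact hDN i (by omega)
  refine ⟨s, hs.le, fun x hx => ?_, fun x hx => ?_, hs.frontier_subset⟩
  · have := hs.valid x
    rwa [h1 _ (by omega), h1 _ (by omega)] at this
  · have := (hD'.of_even (hs.le x) (by omega) (hs.valid x)).1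
    rwa [hx, h1 _ le_rfl] at this

/-- The middle section: it lies above the lower section `s` and is obtained from the staircase of
the complements of the sets `D i ∪ {x | i ≤ s x}`. -/
theorem IsStaircase.exists_mid {k : ℕ} {D N : ℕ → Set X} (hD : IsStaircase (k + 1) D)
    (hDN : ∀ i ≤ 2 * k + 3, frontier (D i) ⊆ N i)
    (ih : ∀ D' N' : ℕ → Set X, IsStaircase k D' → (∀ i, IsOpen (N' i)) →
      (∀ i ≤ 2 * k + 1, frontier (D' i) ⊆ N' i) → ∃ s, IsStaircaseSection k D' N' s)
    (hN : ∀ i, IsOpen (N i))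
    (hNe : ∀ i, i % 2 = 0 → N i ⊆ interior (D (i - 1)) ∧ N i ⊆ interior (D (i + 1)))
    {s : X → ℕ} (hs : ∀ x, s x ≤ 2 * k)
    (hsv : ∀ x, s x < 2 * k → ¬(x ∈ D (s x) ↔ x ∈ D (s x + 1)))
    (hsN : ∀ i, frontier {x | i ≤ s x} ⊆ N i) :
    ∃ m : X → ℕ, (∀ x, 1 ≤ m x ∧ m x ≤ 2 * k + 1) ∧
      (∀ x, s x = 2 * k → m x = 2 * k + 1) ∧
      (∀ x, m x < 2 * k + 1 → ¬(x ∈ D (m x) ↔ x ∈ D (m x + 1))) ∧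
      (∀ x, m x = 2 * k + 1 → x ∈ D (2 * k + 1) ∨ s x = 2 * k) ∧
      ∀ i, frontier {x | i ≤ m x} ⊆ N i := by
  let R : ℕ → Set X := fun i => if i ≤ 2 * k then D i ∪ {x | i ≤ s x}
    else if i = 2 * k + 1 then D i ∪ {x | 2 * k ≤ s x} else ∅
  have hR : ∀ i ≤ 2 * k, R i = D i ∪ {x | i ≤ s x} := fun i hi => if_pos hi
  have hR1 : R (2 * k + 1) = D (2 * k + 1) ∪ {x | 2 * k ≤ s x} := by simp [R]
  have hR2 : R (2 * k + 2) = ∅ := by simp [R]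
  have hDR : ∀ i ≤ 2 * k + 1, D i ⊆ R i := fun i hi => by
    rcases hi.eq_or_lt with rfl | hi'
    · rw [hR1]; exact subset_union_left
    · rw [hR i (by omega)]; exact subset_union_left
  have hsR : ∀ i ≤ 2 * k, {x | i ≤ s x} ⊆ R i := fun i hi => by
    rw [hR i hi]; exact subset_union_right
  -- The section `s` takes an even value `i` only inside `D (i + 1)`.
  have hsR' : ∀ i ≤ 2 * k, i % 2 = 0 → {x | i ≤ s x} ⊆ R (i + 1) := by
    intro i hi h x hx
    rcases hi.eq_or_lt with rfl | hi'
    · rw [hR1]; exact Or.inr hx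
    · rcases (show i ≤ s x from hx).eq_or_lt with h' | h'
      · have := hsv x (by omega)
        rw [← h'] at this
        exact hDR _ (by omega) (hD.of_even (by omega) h this).2
      · exact hsR _ (by omega) h'
  have hRs : IsStaircase k fun j => (R (j + 1))ᶜ := by
    refine ⟨?_, ?_, fun i hi h => ?_, fun i hi h => ?_⟩
    · exact compl_empty_iff.2 (eq_univ_of_forall fun x => hsR' 0 (by omega) rfl (Nat.zero_le _))
    · change (R (2 * k + 2))ᶜ = univ
      rw [hR2, compl_empty]
    · change closure (R (i + 1))ᶜ ⊆ interior (R (i + 2))ᶜ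
      rw [closure_compl, interior_compl, compl_subset_compl]
      rcases hi.eq_or_lt with rfl | hi'
      · simp [hR2]
      · rw [hR (i + 2) (by omega), closure_union]
        rintro x (hx | hx)
        · exact interior_mono (hDR _ (by omega)) (hD.odd (i + 1) (by omega) (by omega) hx)
        · by_cases hf : x ∈ frontier {x | i + 2 ≤ s x}
          · exact interior_mono (hDR _ (by omega)) ((hNe (i + 2) (by omega)).1 (hsN _ hf))
          · refine mem_interior_of_notMem_frontier hx hf (Subset.trans ?_ (hsR _ (by omega)))
            intro y hy
            exact (Nat.le_succ _).trans hy
    · change closure (R (i + 2))ᶜ ⊆ interior (R (i + 1))ᶜ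
      rw [closure_compl, interior_compl, compl_subset_compl, hR (i + 1) (by omega), closure_union]
      rintro x (hx | hx)
      · exact interior_mono (hDR _ (by omega)) (hD.even (i + 1) (by omega) (by omega) hx)
      · by_cases hf : x ∈ frontier {x | i + 1 ≤ s x}
        · exact interior_mono (hDR _ (by omega)) ((hNe (i + 1) (by omega)).2 (hsN _ hf))
        · exact mem_interior_of_notMem_frontier hx hf (hsR' (i + 1) (by omega) (by omega))
  have hRN : ∀ i ≤ 2 * k + 2, frontier (R i) ⊆ N i := by
    intro i hi
    rcases hi.eq_or_lt with rfl | hi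
    · simp [hR2]
    rcases (Nat.lt_succ_iff.1 hi).eq_or_lt with rfl | hi
    · rintro x ⟨hx, hx'⟩
      have hxD : x ∉ interior (D (2 * k + 1)) :=
        fun h => hx' (interior_mono (hDR _ le_rfl) h)
      rw [hR1, closure_union] at hx
      rcases hx with hx | hx
      · exact hDN _ (by omega) ⟨hx, hxD⟩
      · by_cases hf : x ∈ frontier {x | 2 * k ≤ s x}
        · exact absurd ((hNe (2 * k) (by omega)).2 (hsN _ hf)) hxD
        · exact absurd (mem_interior_of_notMem_frontier hx hf (hsR' _ le_rfl (by omega))) hx'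
    · rw [hR i (by omega)]
      refine (frontier_union_subset _ _).trans (union_subset ?_ ?_)
      · exact inter_subset_left.trans (hDN i (by omega))
      · exact inter_subset_right.trans (hsN i)
  obtain ⟨m, hm⟩ := ih (fun j => (R (j + 1))ᶜ) (fun j => N (j + 1)) hRs (fun i => hN _)
    fun i hi => by
      rw [frontier_compl]
      exact hRN _ (by omega)
  have hmR : ∀ x, ¬(x ∈ R (m x + 1) ↔ x ∈ R (m x + 2)) := fun x h => hm.valid x (not_congr h)
  refine ⟨fun x => m x + 1, fun x => ⟨Nat.le_add_left _ _, Nat.succ_le_succ (hm.le x)⟩,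
    fun x hx => ?_, fun x hx => ?_, fun x hx => ?_, fun i => ?_⟩
  · by_contra hne
    dsimp only at hne
    have hle := hm.le x
    refine hmR x (iff_of_true (hsR _ (by omega) (by rw [mem_ofPred_eq]; omega)) ?_)
    rcases (show m x + 2 ≤ 2 * k + 1 by omega).eq_or_lt with h | h
    · rw [h, hR1]
      exact Or.inr hx.ge
    · exact hsR _ (by omega) (by rw [mem_ofPred_eq]; omega)
  · dsimp only at hx ⊢
    have hlt : m x < 2 * k := by omega
    rcases Nat.mod_two_eq_zero_or_one (m x) with h | h
    · -- The level `m x + 1` is odd.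
      have h1 := hRs.of_even hlt.le h (hm.valid x)
      have h2 : x ∈ R (m x + 1) := not_not.1 h1.1
      have h3 : x ∉ R (m x + 2) := h1.2
      rw [hR _ (by omega)] at h2 h3
      have h4 : x ∉ D (m x + 2) := fun h => h3 (Or.inl h)
      have h5 : ¬ m x + 2 ≤ s x := fun h => h3 (Or.inr h)
      refine fun hiff => h4 (hiff.1 ?_)
      rcases h2 with h2 | h2
      · exact h2
      · have h6 : s x = m x + 1 := by rw [mem_ofPred_eq] at h2; omega
        have h7 := hsv x (by omega)
        rw [h6] at h7
        exact (hD.of_odd (by omega) (by omega) h7).1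
    · -- The level `m x + 1` is even.
      have h1 := hRs.of_odd hlt.le h (hm.valid x)
      have h2 : x ∉ R (m x + 1) := h1.1
      have h3 : x ∈ R (m x + 2) := not_not.1 h1.2
      have h4 : x ∉ D (m x + 1) := fun h => h2 (hDR _ (by omega) h)
      have h5 : ¬ m x + 1 ≤ s x := fun h => h2 (hsR _ (by omega) h)
      refine fun hiff => h4 (hiff.2 ?_)
      rcases (show m x + 2 ≤ 2 * k + 1 by omega).eq_or_lt with h6 | h6
      · rw [h6, hR1] at h3
        rcases h3 with h3 | h3
        · rwa [← h6] at h3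
        · rw [mem_ofPred_eq] at h3; omega
      · rw [hR _ (by omega)] at h3
        rcases h3 with h3 | h3
        · exact h3
        · rw [mem_ofPred_eq] at h3; omega
  · dsimp only at hx
    have h1 := hRs.of_even (i := m x) (by omega) (by omega) (hm.valid x)
    have h2 : x ∈ R (m x + 1) := not_not.1 h1.1
    rw [show m x + 1 = 2 * k + 1 from hx, hR1] at h2
    refine h2.imp_right fun h => le_antisymm (hs x) h
  · rcases i with _ | i
    · simp
    · simpa using hm.frontier_subset i

/-- The upper section: it lies above the middle section `m` and is obtained from the staircase of
the sets `D i ∩ {x | m x < i}`. -/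
theorem IsStaircase.exists_high {k : ℕ} {D N : ℕ → Set X} (hD : IsStaircase (k + 1) D)
    (hDN : ∀ i ≤ 2 * k + 3, frontier (D i) ⊆ N i)
    (ih : ∀ D' N' : ℕ → Set X, IsStaircase k D' → (∀ i, IsOpen (N' i)) →
      (∀ i ≤ 2 * k + 1, frontier (D' i) ⊆ N' i) → ∃ s, IsStaircaseSection k D' N' s)
    (hN : ∀ i, IsOpen (N i))
    (hNo : ∀ i, i % 2 = 1 → Disjoint (N i) (closure (D (i - 1))) ∧
        Disjoint (N i) (closure (D (i + 1))))
    {m : X → ℕ} (hm : ∀ x, 1 ≤ m x ∧ m x ≤ 2 * k + 1)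
    (hmv : ∀ x, m x < 2 * k + 1 → ¬(x ∈ D (m x) ↔ x ∈ D (m x + 1)))
    (hmN : ∀ i, frontier {x | i ≤ m x} ⊆ N i) :
    ∃ s : X → ℕ, (∀ x, s x ≤ 2 * k + 2) ∧
      (∀ x, m x = 2 * k + 1 → s x = 2 * k + 2) ∧
      (∀ x, s x < 2 * k + 2 → ¬(x ∈ D (s x) ↔ x ∈ D (s x + 1))) ∧
      (∀ x, s x = 2 * k + 2 → x ∉ D (2 * k + 2) ∨ m x = 2 * k + 1) ∧
      ∀ i, frontier {x | i ≤ s x} ⊆ N i := by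
  have hmN' : ∀ i, frontier {x | m x < i} ⊆ N i := fun i => by
    have : {x | m x < i} = {x | i ≤ m x}ᶜ := by ext; simp
    rw [this, frontier_compl]
    exact hmN i
  let H : ℕ → Set X := fun i => if i ≤ 2 * k + 1 then D i ∩ {x | m x < i}
    else if i = 2 * k + 2 then D i ∩ {x | m x < 2 * k + 1} else univ
  have hH : ∀ i ≤ 2 * k + 1, H i = D i ∩ {x | m x < i} := fun i hi => if_pos hi
  have hH1 : H (2 * k + 2) = D (2 * k + 2) ∩ {x | m x < 2 * k + 1} := by simp [H]
  have hH2 : H (2 * k + 3) = univ := by simp [H]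
  have hHD : ∀ i ≤ 2 * k + 2, H i ⊆ D i := fun i hi => by
    rcases hi.eq_or_lt with rfl | hi'
    · rw [hH1]; exact inter_subset_left
    · rw [hH i (by omega)]; exact inter_subset_left
  -- The section `m` takes an odd value `i` only outside `D (i + 1)`.
  have hHm : ∀ i ≤ 2 * k + 1, i % 2 = 1 → H (i + 1) ⊆ {x | m x < i} := by
    intro i hi h x hx
    rcases hi.eq_or_lt with rfl | hi'
    · rw [hH1] at hx; exact hx.2
    · rw [hH _ (by omega)] at hx
      rcases (Nat.lt_succ_iff.1 hx.2).eq_or_lt with h' | h'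
      · have := hmv x (by omega)
        rw [h'] at this
        exact absurd hx.1 (hD.of_odd (by omega) h this).2
      · exact h'
  have hHs : IsStaircase k fun j => H (j + 2) := by
    refine ⟨?_, hH2, fun i hi h => ?_, fun i hi h => ?_⟩
    · refine eq_empty_of_forall_notMem fun x hx => ?_
      have := hHm 1 (by omega) rfl hx
      have := (hm x).1
      rw [mem_ofPred_eq] at *
      omega
    · change closure (H (i + 2)) ⊆ interior (H (i + 3))
      rcases hi.eq_or_lt with rfl | hi'
      · rw [hH2, interior_univ]; exact subset_univ _
      · intro x hx
        have hxD := closure_mono (hHD _ (by omega)) hx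
        rw [hH (i + 3) (by omega), interior_inter]
        refine ⟨hD.even (i + 2) (by omega) (by omega) hxD, ?_⟩
        by_contra hxi
        have hsub : H (i + 2) ⊆ {x | m x < i + 3} := by
          rw [hH _ (by omega)]
          exact fun y hy => (show m y < i + 2 from hy.2).trans (Nat.lt_succ_self _)
        exact disjoint_left.1 (hNo (i + 3) (by omega)).1
          (hmN' _ ⟨closure_mono hsub hx, hxi⟩) hxD
    · change closure (H (i + 3)) ⊆ interior (H (i + 2))
      intro x hx
      have hxD := closure_mono (hHD _ (by omega)) hx
      rw [hH (i + 2) (by omega), interior_inter]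
      refine ⟨hD.odd (i + 2) (by omega) (by omega) hxD, ?_⟩
      by_contra hxi
      exact disjoint_left.1 (hNo (i + 2) (by omega)).2
        (hmN' _ ⟨closure_mono (hHm (i + 2) (by omega) (by omega)) hx, hxi⟩) hxD
  have hHN : ∀ i ≤ 2 * k + 3, frontier (H i) ⊆ N i := by
    intro i hi
    rcases hi.eq_or_lt with rfl | hi
    · simp [hH2]
    rcases (Nat.lt_succ_iff.1 hi).eq_or_lt with rfl | hi
    · rw [hH1]
      intro x hx
      rcases frontier_inter_subset _ _ hx with h | h
      · exact hDN _ (by omega) h.1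
      · exact absurd h.1 (disjoint_left.1 (hNo (2 * k + 1) (by omega)).2 (hmN' _ h.2))
    · rw [hH i (by omega)]
      refine (frontier_inter_subset _ _).trans (union_subset ?_ ?_)
      · exact inter_subset_left.trans (hDN i (by omega))
      · exact inter_subset_right.trans (hmN' i)
  obtain ⟨s, hs⟩ := ih (fun j => H (j + 2)) (fun j => N (j + 2)) hHs (fun i => hN _)
    fun i hi => hHN _ (by omega)
  refine ⟨fun x => s x + 2, fun x => Nat.add_le_add_right (hs.le x) 2,
    fun x hx => ?_, fun x hx => ?_, fun x hx => ?_, fun i => ?_⟩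
  · by_contra hne
    dsimp only at hne
    have hle := hs.le x
    refine hs.valid x (iff_of_false ?_ ?_)
    · rw [hH _ (by omega)]
      rintro ⟨-, h⟩
      rw [mem_ofPred_eq] at h
      omega
    · change x ∉ H (s x + 3)
      rcases (show s x + 3 ≤ 2 * k + 2 by omega).eq_or_lt with h | h
      · rw [h, hH1]
        rintro ⟨-, h⟩
        rw [mem_ofPred_eq] at h
        omega
      · rw [hH _ (by omega)]
        rintro ⟨-, h⟩
        rw [mem_ofPred_eq] at h
        omega
  · dsimp only at hx ⊢
    have hlt : s x < 2 * k := by omega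
    rcases Nat.mod_two_eq_zero_or_one (s x) with h | h
    · have h1 := hHs.of_even hlt.le h (hs.valid x)
      have h2 : x ∉ H (s x + 2) := h1.1
      have h3 : x ∈ H (s x + 3) := h1.2
      rw [hH _ (by omega)] at h2 h3
      refine fun hiff => h2 ⟨hiff.2 h3.1, ?_⟩
      by_contra h4
      have h5 : m x = s x + 2 := by
        have : m x < s x + 3 := h3.2
        rw [mem_ofPred_eq] at h4
        omega
      have h6 := hmv x (by omega)
      rw [h5] at h6
      exact h6 hiff
    · have h1 := hHs.of_odd hlt.le h (hs.valid x)
      have h2 : x ∈ H (s x + 2) := h1.1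
      have h3 : x ∉ H (s x + 3) := h1.2
      rw [hH _ (by omega)] at h2
      refine fun hiff => h3 ?_
      have h4 : m x < s x + 2 := h2.2
      rcases (show s x + 3 ≤ 2 * k + 2 by omega).eq_or_lt with h5 | h5
      · rw [h5, hH1, ← h5]
        exact ⟨hiff.1 h2.1, by rw [mem_ofPred_eq]; omega⟩
      · rw [hH _ (by omega)]
        exact ⟨hiff.1 h2.1, by rw [mem_ofPred_eq]; omega⟩
  · dsimp only at hx
    have h1 := hHs.of_even (i := s x) (by omega) (by omega) (hs.valid x)
    have h2 : x ∉ H (s x + 2) := h1.1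
    rw [hx, hH1] at h2
    by_contra! h3
    refine h2 ⟨h3.1, ?_⟩
    have := (hm x).2
    rw [mem_ofPred_eq]
    omega
  · rcases i with _ | _ | i
    · simp
    · simp
    · simpa using hs.frontier_subset i

theorem frontier_congr_of_isOpen {S T O : Set X} (hO : IsOpen O) (h : ∀ y ∈ O, y ∈ S ↔ y ∈ T)
    {x : X} (hx : x ∈ frontier S) (hxO : x ∈ O) : x ∈ frontier T := by
  have hST : S ∩ O = T ∩ O := by
    ext y
    exact ⟨fun hy => ⟨(h y hy.2).1 hy.1, hy.2⟩, fun hy => ⟨(h y hy.2).2 hy.1, hy.2⟩⟩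
  have hx' : x ∈ frontier S ∩ O := ⟨hx, hxO⟩
  rw [← frontier_inter_open_inter hO, hST, frontier_inter_open_inter hO] at hx'
  exact hx'.1

/-- Over a neighbourhood on which a function takes only two consecutive values `n` and `n + 1`, the
only superlevel set with frontier is the one of level `n + 1`. -/
theorem eq_of_mem_frontier_of_two_values {s : X → ℕ} {O : Set X} (hO : IsOpen O) {n i : ℕ}
    (h : ∀ y ∈ O, n ≤ s y ∧ s y ≤ n + 1) {x : X} (hx : x ∈ frontier {y | i ≤ s y})
    (hxO : x ∈ O) : i = n + 1 := by
  rcases lt_trichotomy i (n + 1) with hi | hi | hi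
  · have := frontier_congr_of_isOpen (T := univ) hO
      (fun y hy => iff_of_true (by have := h y hy; rw [mem_ofPred_eq]; omega) trivial) hx hxO
    simp at this
  · exact hi
  · have := frontier_congr_of_isOpen (T := ∅) hO
      (fun y hy => iff_of_false (by have := h y hy; rw [mem_ofPred_eq]; omega) id) hx hxO
    simp at this

/-- In a hereditarily indecomposable space every staircase has a section.  The induction step glues
three sections of shorter staircases along a fold, which is chosen so that the sections to be glued
differ by one level near the two cuts. -/
theorem HereditarilyIndecomposable.exists_isStaircaseSection [CompactSpace X] [T2Space X]
    (hX : HereditarilyIndecomposable X) (k : ℕ) :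
    ∀ D N : ℕ → Set X, IsStaircase k D → (∀ i, IsOpen (N i)) →
      (∀ i ≤ 2 * k + 1, frontier (D i) ⊆ N i) → ∃ s, IsStaircaseSection k D N s := by
  induction k with
  | zero =>
    intro D N hD _ _
    refine ⟨fun _ => 0, fun _ => le_rfl, fun x h => ?_, fun i => ?_⟩
    · have h1 := hD.top
      simp only [Nat.mul_zero, Nat.zero_add] at h1
      rw [Nat.zero_add, hD.zero, h1] at h
      exact h.2 trivial
    · rcases i with _ | i <;> simp
  | succ k ih =>
    intro D N₀ hD hN₀ hDN₀
    obtain ⟨N, hN, hNN, hDN, hNe, hNo⟩ := hD.exists_shrink hN₀ hDN₀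
    obtain ⟨l, hl, hlv, hl', hlN⟩ := hD.exists_low hDN ih hN
    obtain ⟨m, hm, hlm, hmv, hm', hmN⟩ := hD.exists_mid hDN ih hN hNe hl hlv hlN
    obtain ⟨u, hu, hmu, huv, hu', huN⟩ := hD.exists_high hDN ih hN hNo hm hmv hmN
    -- As a section of `D`, the function `l` fails only on `V₁` and `u` only on `V₂`, while `m` fails
    -- only on `V₁ ∪ V₂`.  So the fold has to put `V₂` into the layer of `l` and `V₁` into the layer
    -- of `u`.
    let V₁ : Set X := {x | 2 * k ≤ l x} \ D (2 * k + 1)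
    let V₂ : Set X := {x | 2 * k + 1 ≤ m x} ∩ D (2 * k + 2)
    have hV₁ : closure V₁ ⊆ (interior (D (2 * k + 1)))ᶜ := by
      rw [← closure_compl]
      exact closure_mono fun x hx => hx.2
    have hV₂ : closure V₂ ⊆ closure (D (2 * k + 2)) := closure_mono inter_subset_right
    have hdisj : Disjoint (closure V₂) (closure V₁) := disjoint_left.2 fun x h₂ h₁ =>
      hV₁ h₁ (hD.odd (2 * k + 1) (by omega) (by omega) (hV₂ h₂))
    obtain ⟨X₀, X₁, X₂, hX₀, hX₁, hX₂, hcov, hA, hB, h02, h01, h12⟩ := hX.exists_fold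
      (WA := interior {x | 2 * k + 1 ≤ m x} ∩ (interior (D (2 * k + 2)) ∪ N (2 * k + 2)))
      (WB := interior {x | 2 * k ≤ l x} ∩ ((closure (D (2 * k + 1)))ᶜ ∪ N (2 * k + 1)))
      isClosed_closure isClosed_closure hdisj
      (isOpen_interior.inter (isOpen_interior.union (hN _)))
      (fun x hx => by
        refine ⟨?_, ?_⟩
        · by_contra hi
          exact disjoint_left.1 (hNo (2 * k + 1) (by omega)).2
            (hmN _ ⟨closure_mono inter_subset_left hx, hi⟩) (hV₂ hx)
        · by_cases hi : x ∈ interior (D (2 * k + 2))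
          · exact Or.inl hi
          · exact Or.inr (hDN _ (by omega) ⟨hV₂ hx, hi⟩))
      (isOpen_interior.inter (isClosed_closure.isOpen_compl.union (hN _)))
      (fun x hx => by
        refine ⟨?_, ?_⟩
        · by_contra hi
          exact hV₁ hx ((hNe (2 * k) (by omega)).2
            (hlN _ ⟨closure_mono sdiff_subset hx, hi⟩))
        · by_cases hi : x ∈ closure (D (2 * k + 1))
          · exact Or.inr (hDN _ (by omega) ⟨hi, hV₁ hx⟩)
          · exact Or.inl hi)
    have hV₁X : ∀ x ∉ X₂, l x = 2 * k → x ∈ D (2 * k + 1) := fun x hx h => by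
      by_contra h'
      exact hx (hB (subset_closure ⟨h.ge, h'⟩))
    have hV₂X : ∀ x ∉ X₀, m x = 2 * k + 1 → x ∉ D (2 * k + 2) := fun x hx h h' =>
      hx (hA (subset_closure ⟨h.ge, h'⟩))
    have hX02 : ∀ x ∈ X₀, x ∉ X₂ := fun x hx => disjoint_left.1 h02 hx
    have hint : ∀ {y}, y ∈ interior {x | 2 * k ≤ l x} → 2 * k ≤ l y :=
      fun h => interior_subset (s := {x | 2 * k ≤ l x}) h
    have hint' : ∀ {y}, y ∈ interior {x | 2 * k + 1 ≤ m x} → 2 * k + 1 ≤ m y :=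
      fun h => interior_subset (s := {x | 2 * k + 1 ≤ m x}) h
    classical
    let s : X → ℕ := fun x => if x ∈ X₀ then l x else if x ∈ X₂ then u x else m x
    have hs₀ : ∀ x ∈ X₀, s x = l x := fun x hx => if_pos hx
    have hs₂ : ∀ x ∈ X₂, s x = u x := fun x hx => by
      simp only [s, if_neg fun h => hX02 x h hx, if_pos hx]
    have hs₁ : ∀ x ∉ X₀, x ∉ X₂ → s x = m x := fun x h₀ h₂ => by
      simp only [s, if_neg h₀, if_neg h₂]
    refine ⟨s, fun x => ?_, fun x => ?_, fun i x hx => hNN i ?_⟩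
    · by_cases h₀ : x ∈ X₀
      · have := hl x
        rw [hs₀ x h₀]
        omega
      by_cases h₂ : x ∈ X₂
      · rw [hs₂ x h₂]
        exact hu x
      · have := hm x
        rw [hs₁ x h₀ h₂]
        omega
    · by_cases h₀ : x ∈ X₀
      · rw [hs₀ x h₀]
        rcases (hl x).eq_or_lt with h | h
        · rw [h]
          exact fun hiff => hl' x h (hiff.2 (hV₁X x (hX02 x h₀) h))
        · exact hlv x h
      by_cases h₂ : x ∈ X₂
      · rw [hs₂ x h₂]
        rcases (hu x).eq_or_lt with h | h
        · rw [h]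
          have hxD : x ∉ D (2 * k + 2) := (hu' x h).elim id (hV₂X x h₀)
          refine fun hiff => hxD (hiff.2 ?_)
          rw [show 2 * k + 2 + 1 = 2 * (k + 1) + 1 by omega, hD.top]
          trivial
        · exact huv x h
      · rw [hs₁ x h₀ h₂]
        rcases (hm x).2.eq_or_lt with h | h
        · rw [h]
          have hxD : x ∈ D (2 * k + 1) := (hm' x h).elim id (hV₁X x h₂)
          exact fun hiff => hV₂X x h₀ h (hiff.1 hxD)
        · exact hmv x h
    · have hcov' : ∀ y, y ∈ X₀ ∨ y ∈ X₁ ∨ y ∈ X₂ := fun y => by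
        have : y ∈ X₀ ∪ X₁ ∪ X₂ := hcov ▸ mem_univ y
        rwa [union_assoc] at this
      by_cases h₁ : x ∈ X₁
      · by_cases h₀ : x ∈ X₀
        · -- The cut between `l` and `m`.
          have hW := h01 ⟨h₀, h₁⟩
          have hi : i = 2 * k + 1 := by
            refine eq_of_mem_frontier_of_two_values (hX₂.isOpen_compl.inter isOpen_interior)
              (fun y hy => ?_) hx ⟨hX02 x h₀, hW.1⟩
            have h2 : l y = 2 * k := le_antisymm (hl y) (hint hy.2)
            have h3 := hlm y h2
            by_cases hy₀ : y ∈ X₀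
            · rw [hs₀ y hy₀]; omega
            · rw [hs₁ y hy₀ hy.1]; omega
          rw [hi]
          refine hW.2.resolve_left fun h => h (subset_closure (hV₁X x (hX02 x h₀) ?_))
          exact le_antisymm (hl x) (hint hW.1)
        by_cases h₂ : x ∈ X₂
        · -- The cut between `m` and `u`.
          have hW := h12 ⟨h₁, h₂⟩
          have hi : i = 2 * k + 1 + 1 := by
            refine eq_of_mem_frontier_of_two_values (hX₀.isOpen_compl.inter isOpen_interior)
              (fun y hy => ?_) hx ⟨h₀, hW.1⟩
            have h2 : m y = 2 * k + 1 := le_antisymm (hm y).2 (hint' hy.2)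
            have h3 := hmu y h2
            by_cases hy₂ : y ∈ X₂
            · rw [hs₂ y hy₂]; omega
            · rw [hs₁ y hy.1 hy₂]; omega
          rw [hi]
          refine hW.2.resolve_left fun h => hV₂X x h₀ ?_ (interior_subset h)
          exact le_antisymm (hm x).2 (hint' hW.1)
        · refine hmN i (frontier_congr_of_isOpen (hX₀.union hX₂).isOpen_compl
            (fun y hy => ?_) hx fun h => h.elim h₀ h₂)
          rw [mem_ofPred_eq, mem_ofPred_eq,
            hs₁ y (fun h => hy (Or.inl h)) (fun h => hy (Or.inr h))]
      · by_cases h₀ : x ∈ X₀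
        · refine hlN i (frontier_congr_of_isOpen (hX₁.union hX₂).isOpen_compl
            (fun y hy => ?_) hx fun h => h.elim h₁ (hX02 x h₀))
          rw [mem_ofPred_eq, mem_ofPred_eq, hs₀ y ((hcov' y).resolve_right hy)]
        · refine huN i (frontier_congr_of_isOpen (hX₀.union hX₁).isOpen_compl
            (fun y hy => ?_) hx fun h => h.elim h₀ h₁)
          have hy₂ : y ∈ X₂ := ((hcov' y).resolve_left fun h => hy (Or.inl h)).resolve_left
            fun h => hy (Or.inr h)
          rw [mem_ofPred_eq, mem_ofPred_eq, hs₂ y hy₂]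

end

/-! ### Continuous interpolation of heights -/

open Filter Topology in
/-- A function with finitely many natural values is turned into a continuous one that moves away
from it only along intervals `[j - 1, j]` and only over the prescribed neighbourhoods `N j` of the
frontiers of the superlevel sets. -/
theorem exists_continuous_of_frontier_subset {X : Type*} [TopologicalSpace X] [CompactSpace X]
    [T2Space X] {c : X → ℕ} {K : ℕ} (hc : ∀ x, c x ≤ K) {N : ℕ → Set X} (hN : ∀ j, IsOpen (N j))
    (hcN : ∀ j, frontier {x | j ≤ c x} ⊆ N j) :
    ∃ τ : C(X, ℝ), ∀ x, τ x = c x ∨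
      ∃ j < K, x ∈ N (j + 1) ∧ (j : ℝ) ≤ τ x ∧ τ x ≤ j + 1 := by
  -- The heights to which one may pass from `c x` at the point `x`.
  let A : X → Set ℕ := fun x => {n | n ≤ K ∧ ∀ j, (n < j ∧ j ≤ c x) ∨ (c x < j ∧ j ≤ n) → x ∈ N j}
  let T : X → Set ℝ := fun x => {t | ∃ m ∈ A x, ∃ n ∈ A x, (m : ℝ) ≤ t ∧ t ≤ n}
  have hT : ∀ x, Convex ℝ (T x) := fun x => by
    refine (ordConnected_iff.2 ?_).convex
    rintro a ⟨m, hm, _, _, hma, -⟩ b ⟨_, _, n, hn, -, hbn⟩ - t ht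
    exact ⟨m, hm, n, hn, hma.trans ht.1, ht.2.trans hbn⟩
  have hloc : ∀ x, ∀ᶠ y in 𝓝 x, ∀ j ∈ Iic K,
      (c x < j ∧ j ≤ c y) ∨ (c y < j ∧ j ≤ c x) → y ∈ N j := by
    intro x
    refine (eventually_all_finite (finite_Iic K)).2 fun j _ => ?_
    by_cases hf : x ∈ frontier {x | j ≤ c x}
    · filter_upwards [(hN j).mem_nhds (hcN j hf)] with y hy _ using hy
    · by_cases hj : j ≤ c x
      · have hx : x ∈ interior {x | j ≤ c x} := by
          by_contra hx
          exact hf ⟨subset_closure hj, hx⟩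
        filter_upwards [mem_interior_iff_mem_nhds.1 hx] with y hy h
        have : j ≤ c y := hy
        omega
      · have hx : x ∉ closure {x | j ≤ c x} := fun hx =>
          hf ⟨hx, fun h => hj (interior_subset (s := {x | j ≤ c x}) h)⟩
        filter_upwards [isClosed_closure.isOpen_compl.mem_nhds hx] with y hy h
        have : ¬j ≤ c y := fun h => hy (subset_closure h)
        omega
  obtain ⟨τ, hτ⟩ := exists_continuous_forall_mem_convex_of_local_const hT fun x =>
    ⟨(c x : ℝ), (hloc x).mono fun y hy => by
      have : c x ∈ A y := ⟨hc x, fun j hj => hy j (by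
        have := hc x
        have := hc y
        rw [mem_Iic]
        omega) hj⟩
      exact ⟨c x, this, c x, this, le_rfl, le_rfl⟩⟩
  refine ⟨τ, fun x => ?_⟩
  obtain ⟨m, hm, n, hn, hmt, htn⟩ := hτ x
  have h0 : 0 ≤ τ x := (Nat.cast_nonneg m).trans hmt
  rcases lt_trichotomy (τ x) (c x) with h | h | h
  · have h1 := Nat.floor_le h0
    have h2 := Nat.lt_floor_add_one (τ x)
    have h3 : m ≤ ⌊τ x⌋₊ := Nat.le_floor hmt
    have h4 : ⌊τ x⌋₊ < c x := Nat.cast_lt (α := ℝ).1 (h1.trans_lt h)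
    exact Or.inr ⟨⌊τ x⌋₊, h4.trans_le (hc x), hm.2 _ (Or.inl ⟨by omega, h4⟩), h1, h2.le⟩
  · exact Or.inl h
  · have h1 := Nat.le_ceil (τ x)
    have h2 := Nat.ceil_lt_add_one h0
    have h3 : ⌈τ x⌉₊ ≤ n := Nat.ceil_le.2 htn
    have h4 : c x < ⌈τ x⌉₊ := Nat.cast_lt (α := ℝ).1 (h.trans_le h1)
    obtain ⟨j, hj⟩ : ∃ j, ⌈τ x⌉₊ = j + 1 := ⟨⌈τ x⌉₊ - 1, by omega⟩
    rw [hj] at h1 h2 h3 h4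
    push_cast at h1 h2
    exact Or.inr ⟨j, by have := hn.1; omega, hn.2 _ (Or.inr ⟨h4, h3⟩), by linarith, h1⟩

/-- A finite sequence of functions that rises from `0` to `1` in small steps: in a hereditarily
indecomposable space one can choose the index continuously, up to a bounded error, so that the
function of that index takes intermediate values only. -/
theorem HereditarilyIndecomposable.exists_continuous_index {X : Type*} [TopologicalSpace X]
    [CompactSpace X] [T2Space X] (hX : HereditarilyIndecomposable X) {K : ℕ} {φ : ℕ → X → ℝ}
    (hφ : ∀ j, Continuous (φ j)) (h0 : ∀ x, φ 0 x = 0) (hK : ∀ x, φ K x = 1)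
    (hstep : ∀ j x, |φ j x - φ (j + 1) x| < 1 / 8) :
    ∃ τ : C(X, ℝ), ∀ x, ∃ j : ℕ, |τ x - j| ≤ 1 ∧ φ j x ∈ Ioo (1 / 2 : ℝ) (3 / 4) := by
  -- For `i = 0` the truncated subtraction makes the minimum equal to `φ 0`.
  let ψ : ℕ → X → ℝ := fun i x =>
    if i % 2 = 1 then φ (i / 2) x - 1 / 2 else min (φ (i / 2 - 1) x) (φ (i / 2) x) - 5 / 8
  have hodd : ∀ j x, ψ (2 * j + 1) x = φ j x - 1 / 2 := fun j x => by
    simp only [ψ]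
    rw [if_pos (by omega), show (2 * j + 1) / 2 = j by omega]
  have heven : ∀ j x, ψ (2 * j) x = min (φ (j - 1) x) (φ j x) - 5 / 8 := fun j x => by
    simp only [ψ]
    rw [if_neg (by omega), show 2 * j / 2 = j by omega]
  have heven' : ∀ j x, ψ (2 * j + 2) x = min (φ j x) (φ (j + 1) x) - 5 / 8 := fun j x =>
    heven (j + 1) x
  have hψ : ∀ i, Continuous (ψ i) := fun i => by
    by_cases hi : i % 2 = 1
    · simp only [ψ, if_pos hi]
      exact (hφ _).sub continuous_const
    · simp only [ψ, if_neg hi]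
      exact ((hφ _).min (hφ _)).sub continuous_const
  have hcl : ∀ i, closure {x | 0 < ψ i x} ⊆ {x | 0 ≤ ψ i x} := fun i =>
    closure_lt_subset_le continuous_const (hψ i)
  have hint : ∀ i, {x | 0 < ψ i x} ⊆ interior {x | 0 < ψ i x} := fun i =>
    (isOpen_lt continuous_const (hψ i)).subset_interior_iff.2 le_rfl
  have hstair : IsStaircase K fun i => {x | 0 < ψ i x} := by
    refine ⟨eq_empty_of_forall_notMem fun x hx => ?_, eq_univ_of_forall fun x => ?_,
      fun i _ hi => (hcl i).trans (Subset.trans (fun x hx => ?_) (hint (i + 1))),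
      fun i _ hi => (hcl (i + 1)).trans (Subset.trans (fun x hx => ?_) (hint i))⟩
    · have h1 := heven 0 x
      rw [Nat.zero_sub, min_self, h0] at h1
      have h2 : 0 < ψ 0 x := hx
      rw [show 2 * 0 = 0 from rfl] at h1
      linarith
    · change 0 < ψ (2 * K + 1) x
      rw [hodd, hK]
      norm_num
    · obtain ⟨j, rfl⟩ : ∃ j, i = 2 * j := ⟨i / 2, by omega⟩
      change 0 < ψ (2 * j + 1) x
      have h1 : 0 ≤ ψ (2 * j) x := hx
      rw [heven] at h1
      rw [hodd]
      linarith [min_le_right (φ (j - 1) x) (φ j x)]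
    · obtain ⟨j, rfl⟩ : ∃ j, i = 2 * j + 1 := ⟨i / 2, by omega⟩
      change 0 < ψ (2 * j + 1) x
      have h1 : 0 ≤ ψ (2 * j + 2) x := hx
      rw [heven'] at h1
      rw [hodd]
      linarith [min_le_left (φ j x) (φ (j + 1) x)]
  obtain ⟨s, hs⟩ := hX.exists_isStaircaseSection K _ (fun i => {x | |ψ i x| < 1 / 8}) hstair
    (fun i => isOpen_lt (hψ i).abs continuous_const) fun i _ x hx => by
      have h1 : 0 = ψ i x := frontier_lt_subset_eq continuous_const (hψ i) hx
      rw [mem_ofPred_eq, ← h1]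
      norm_num
  obtain ⟨τ, hτ⟩ := exists_continuous_of_frontier_subset (c := fun x => s x / 2) (K := K)
    (fun x => by have := hs.le x; omega) (N := fun j => {x | |ψ (2 * j) x| < 1 / 8})
    (fun j => isOpen_lt (hψ _).abs continuous_const) fun j => by
      have : {x | j ≤ s x / 2} = {x | 2 * j ≤ s x} := by
        ext x
        simp only [mem_ofPred_eq]
        omega
      rw [this]
      exact hs.frontier_subset (2 * j)
  refine ⟨τ, fun x => ?_⟩
  rcases hτ x with h | ⟨j, -, hj, h1, h2⟩
  · refine ⟨s x / 2, by rw [h]; simp, ?_⟩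
    rcases Nat.even_or_odd' (s x) with ⟨j, hj | hj⟩
    · have hv := hstair.of_even (hs.le x) (by omega) (hs.valid x)
      rw [hj, mem_ofPred_eq, mem_ofPred_eq, hodd, heven, not_lt] at hv
      rw [show s x / 2 = j by omega]
      refine ⟨by linarith, ?_⟩
      rcases j with _ | j
      · linarith [h0 x]
      · rw [Nat.add_sub_cancel] at hv
        have := abs_lt.1 (hstep j x)
        rcases min_choice (φ j x) (φ (j + 1) x) with hmin | hmin <;> rw [hmin] at hv <;> linarith
    · have hv := hstair.of_odd (hs.le x) (by omega) (hs.valid x)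
      rw [hj, mem_ofPred_eq, mem_ofPred_eq, hodd, heven', not_lt] at hv
      rw [show s x / 2 = j by omega]
      refine ⟨by linarith, ?_⟩
      have := abs_lt.1 (hstep j x)
      rcases min_choice (φ j x) (φ (j + 1) x) with hmin | hmin <;> rw [hmin] at hv <;> linarith
  · have h3 : |ψ (2 * j + 2) x| < 1 / 8 := hj
    rw [heven', abs_lt] at h3
    rcases min_choice (φ j x) (φ (j + 1) x) with hmin | hmin <;> rw [hmin] at h3
    · exact ⟨j, abs_le.2 ⟨by linarith, by linarith⟩, by linarith, by linarith⟩
    · refine ⟨j + 1, abs_le.2 ⟨?_, ?_⟩, by linarith, by linarith⟩ <;> push_cast <;> linarith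

/-- Every function on the cylinder over a hereditarily indecomposable compactum which is `0` on the
bottom and `1` on the top takes intermediate values only along the graph of some continuous
height. -/
theorem HereditarilyIndecomposable.exists_height {X : Type*} [MetricSpace X] [CompactSpace X]
    (hX : HereditarilyIndecomposable X) (Φ : C(X × unitInterval, ℝ)) (h0 : ∀ x, Φ (x, 0) = 0)
    (h1 : ∀ x, Φ (x, 1) = 1) :
    ∃ τ : C(X, unitInterval), ∀ x, Φ (x, τ x) ∈ Ioo (0 : ℝ) 1 := by
  obtain ⟨δ, hδ, hΦ⟩ := Metric.uniformContinuous_iff.1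
    (CompactSpace.uniformContinuous_of_continuous Φ.continuous) (1 / 8) (by norm_num)
  obtain ⟨K, hK0, hK⟩ : ∃ K : ℕ, 0 < K ∧ 1 / (K : ℝ) < δ := by
    obtain ⟨n, hn⟩ := exists_nat_one_div_lt hδ
    exact ⟨n + 1, n.succ_pos, by exact_mod_cast hn⟩
  have hKpos : (0 : ℝ) < K := Nat.cast_pos.2 hK0
  let p : ℝ → unitInterval := fun r => projIcc 0 1 zero_le_one (r / K)
  have hp : Continuous p := continuous_projIcc.comp (continuous_id.div_const _)
  have hclose : ∀ x a b, |a - b| ≤ 1 → |Φ (x, p a) - Φ (x, p b)| < 1 / 8 := by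
    intro x a b hab
    rw [← Real.dist_eq]
    refine hΦ ?_
    rw [dist_prod_same_left, Subtype.dist_eq, Real.dist_eq]
    refine (abs_projIcc_sub_projIcc zero_le_one).trans_lt (lt_of_le_of_lt ?_ hK)
    rw [← sub_div, abs_div, abs_of_pos hKpos]
    gcongr
  obtain ⟨τ, hτ⟩ := hX.exists_continuous_index (K := K) (φ := fun j x => Φ (x, p j))
    (fun j => Φ.continuous.comp (continuous_id.prodMk continuous_const))
    (fun x => by simpa [p] using h0 x) (fun x => by simpa [p, hKpos.ne'] using h1 x)
    (fun j x => hclose x _ _ (by push_cast; simp))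
  refine ⟨⟨fun x => p (τ x), hp.comp τ.continuous⟩, fun x => ?_⟩
  obtain ⟨j, hj, h2, h3⟩ := hτ x
  have h4 := abs_lt.1 (hclose x _ _ hj)
  change Φ (x, p (τ x)) ∈ _
  exact ⟨by linarith, by linarith⟩

/-- The lifting property of hereditarily indecomposable compacta, with the first coordinate of the
lift equal to the given map. -/
theorem HereditarilyIndecomposable.exists_lift {X : Type*} [MetricSpace X] [CompactSpace X]
    (hX : HereditarilyIndecomposable X) {G : Type*} [TopologicalSpace G] (f : C(X, G))
    {M U : Set (G × unitInterval)}
    (hM : Separates M (univ ×ˢ {(0 : unitInterval)}) (univ ×ˢ {(1 : unitInterval)}))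
    (hU : IsOpen U) (hMU : M ⊆ U) :
    ∃ τ : C(X, unitInterval), ∀ x, (f x, τ x) ∈ U := by
  obtain ⟨V₀, V₁, hV₀, hV₁, hcov, hdisj, h₀, h₁⟩ := hM
  let g : X × unitInterval → G × unitInterval := fun p => (f p.1, p.2)
  have hg : Continuous g := (f.continuous.comp continuous_fst).prodMk continuous_snd
  have hcov' : ∀ p ∉ M, p ∈ V₀ ∨ p ∈ V₁ := fun p hp => by
    have : p ∈ (V₀ \ M) ∪ (V₁ \ M) := hcov ▸ hp
    exact this.imp And.left And.left
  have hfst : ∀ t : unitInterval, IsClosed {p : X × unitInterval | p.2 = t} := fun t =>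
    isClosed_eq continuous_snd continuous_const
  obtain ⟨Φ, hΦ0, hΦ1, -⟩ := exists_continuous_zero_one_of_isClosed
    (s := g ⁻¹' (U ∪ V₁)ᶜ ∪ {p | p.2 = 0}) (t := g ⁻¹' (U ∪ V₀)ᶜ ∪ {p | p.2 = 1})
    (((hU.union hV₁).isClosed_compl.preimage hg).union (hfst 0))
    (((hU.union hV₀).isClosed_compl.preimage hg).union (hfst 1)) (by
      rw [disjoint_left]
      rintro ⟨x, t⟩ (hp | hp) (hq | hq)
      · rcases hcov' (g (x, t)) (fun h => hp (Or.inl (hMU h))) with h | h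
        · exact hq (Or.inr h)
        · exact hp (Or.inr h)
      · exact hp (Or.inr (h₁ (show g (x, t) ∈ _ from ⟨trivial, show t = 1 from hq⟩)).1)
      · exact hq (Or.inr (h₀ (show g (x, t) ∈ _ from ⟨trivial, show t = 0 from hp⟩)).1)
      · exact zero_ne_one ((show t = 0 from hp).symm.trans hq))
  obtain ⟨τ, hτ⟩ := hX.exists_height Φ (fun x => hΦ0 (Or.inr rfl)) (fun x => hΦ1 (Or.inr rfl))
  refine ⟨τ, fun x => ?_⟩
  by_contra hx
  have hxM : (f x, τ x) ∉ M := fun h => hx (hMU h)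
  by_cases h : (f x, τ x) ∈ V₁
  · have h' : (f x, τ x) ∉ V₀ := fun h' => disjoint_left.1 hdisj ⟨h', hxM⟩ ⟨h, hxM⟩
    have : Φ (x, τ x) = 1 := hΦ1 (Or.inl fun h'' => h''.elim hx h')
    exact (hτ x).2.ne this
  · have : Φ (x, τ x) = 0 := hΦ0 (Or.inl fun h'' => h''.elim hx h)
    exact (hτ x).1.ne' this

/-! ### Decomposable continua and the arc -/

/-- An arc is a graph. -/
theorem isGraph_ulift_unitInterval : IsGraph (ULift.{v} unitInterval) := by
  refine ⟨1, fun _ => ULift.up, fun _ => ?_, ?_, fun i j hij => absurd (Subsingleton.elim i j) hij⟩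
  · exact Homeomorph.ulift.symm.isEmbedding
  · rw [iUnion_const]
    exact ULift.up_surjective.range_eq

/-- If a continuous function omits the value `c` on a connected set, it stays on one side of it. -/
theorem IsPreconnected.lt_of_forall_ne {X : Type*} [TopologicalSpace X] {A : Set X}
    (hA : IsPreconnected A) {f : X → ℝ} (hf : Continuous f) {c : ℝ} {p : X} (hp : p ∈ A)
    (hpc : f p < c) (hc : ∀ x ∈ A, f x ≠ c) {x : X} (hx : x ∈ A) : f x < c := by
  by_contra! h
  obtain ⟨y, hy, hyc⟩ := hA.intermediate_value hp hx hf.continuousOn ⟨hpc.le, h⟩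
  exact hc y hy hyc

theorem Disjoint.compl_sdiff_compl_union {α : Type*} {S T : Set α} (h : Disjoint S T) :
    Tᶜ \ (S ∪ T)ᶜ = S := by
  rw [sdiff_compl, inter_union_distrib_left, compl_inter_self, union_empty,
    inter_eq_right]
  exact h.subset_compl_right

/-- Lifts for maps to an arc exclude decomposable subcontinua.  The separator is the complement of
two closed sets `C₀` and `C₁`, consisting each of the bottom or top edge of the square, a thick wall
attached to it at one side, and a horizontal shelf attached to the wall.  A lift has to stay below
the shelf of `C₁` over one of the two subcontinua, and above the shelf of `C₀` over the other. -/
theorem not_isDecomposable_of_exists_lift {X : Type*} [MetricSpace X] {K : Set X}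
    (hK : IsConnected K)
    (H : ∀ (f : C(X, ULift.{v} unitInterval)) (M : Set (ULift.{v} unitInterval × unitInterval)),
      M ⊆ univ ×ˢ Ioo (0 : unitInterval) 1 →
      Separates M (univ ×ˢ {(0 : unitInterval)}) (univ ×ˢ {(1 : unitInterval)}) → IsOpen M →
      ∀ ε : ℝ, 0 < ε → ∃ h : C(X, ULift.{v} unitInterval × unitInterval),
        (∀ x, h x ∈ M) ∧ ∀ x, dist (f x) (h x).1 < ε) :
    ¬ IsDecomposable K := by
  rintro ⟨A, B, hA, hB, hAK, hBK, rfl⟩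
  obtain ⟨p, hpB, hpA⟩ : ∃ p ∉ B, p ∈ A := by
    by_contra! h
    exact hBK.2 (union_subset (fun x hx => by_contra fun hxB => h x hxB hx) le_rfl)
  obtain ⟨q, hqA, hqB⟩ : ∃ q ∉ A, q ∈ B := by
    by_contra! h
    exact hAK.2 (union_subset le_rfl fun x hx => by_contra fun hxA => h x hxA hx)
  obtain ⟨z, -, hzA, hzB⟩ : ((A ∪ B) ∩ (A ∩ B)).Nonempty :=
    isPreconnected_closed_iff.1 hK.isPreconnected A B hA.1.isClosed hB.1.isClosed le_rfl
      ⟨p, Or.inl hpA, hpA⟩ ⟨q, Or.inr hqB, hqB⟩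
  -- A function with `F ≤ 1 / 2` on `A`, `F ≥ 1 / 2` on `B`, `F p = 0` and `F q = 1`.
  obtain ⟨u, hu0, hu1, hu⟩ := exists_continuous_zero_one_of_isClosed hB.1.isClosed
    (isClosed_singleton (x := p)) (disjoint_singleton_right.2 hpB)
  obtain ⟨w, hw0, hw1, hw⟩ := exists_continuous_zero_one_of_isClosed hA.1.isClosed
    (isClosed_singleton (x := q)) (disjoint_singleton_right.2 hqA)
  let F : X → ℝ := fun x => (1 - u x + w x) / 2
  have hF : Continuous F := by fun_prop
  have hF01 : ∀ x, F x ∈ Icc (0 : ℝ) 1 := fun x => by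
    have h1 := hu x
    have h2 := hw x
    simp only [F, mem_Icc] at *
    constructor <;> linarith
  let f : C(X, ULift.{v} unitInterval) :=
    ⟨fun x => ⟨⟨F x, hF01 x⟩⟩, continuous_uliftUp.comp (hF.subtype_mk _)⟩
  let Y := ULift.{v} unitInterval × unitInterval
  let a : Y → ℝ := fun y => (y.1.down : ℝ)
  let t : Y → ℝ := fun y => (y.2 : ℝ)
  have ha : Continuous a :=
    continuous_subtype_val.comp (continuous_uliftDown.comp continuous_fst)
  have ht : Continuous t := continuous_subtype_val.comp continuous_snd
  let C₀ : Set Y := {y | t y = 0} ∪ ({y | 9 / 10 ≤ a y} ∩ {y | t y ≤ 5 / 8}) ∪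
    ({y | 2 / 10 ≤ a y} ∩ {y | t y = 5 / 8})
  let C₁ : Set Y := {y | t y = 1} ∪ ({y | a y ≤ 1 / 10} ∩ {y | 3 / 8 ≤ t y}) ∪
    ({y | a y ≤ 8 / 10} ∩ {y | t y = 3 / 8})
  have hC₀ : IsClosed C₀ :=
    ((isClosed_eq ht continuous_const).union ((isClosed_le continuous_const ha).inter
      (isClosed_le ht continuous_const))).union ((isClosed_le continuous_const ha).inter
      (isClosed_eq ht continuous_const))
  have hC₁ : IsClosed C₁ :=
    ((isClosed_eq ht continuous_const).union ((isClosed_le ha continuous_const).inter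
      (isClosed_le continuous_const ht))).union ((isClosed_le ha continuous_const).inter
      (isClosed_eq ht continuous_const))
  have hC : ∀ y ∈ C₀, y ∉ C₁ := by
    rintro y ((h | ⟨h, h'⟩) | ⟨h, h'⟩) ((k | ⟨k, k'⟩) | ⟨k, k'⟩) <;>
      simp only [mem_ofPred_eq] at * <;> linarith
  have h0 : ∀ y : Y, y.2 = 0 → y ∈ C₀ := fun y hy => Or.inl (Or.inl (by simp [t, hy]))
  have h1 : ∀ y : Y, y.2 = 1 → y ∈ C₁ := fun y hy => Or.inl (Or.inl (by simp [t, hy]))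
  have hd₀ : C₁ᶜ \ (C₀ ∪ C₁)ᶜ = C₀ := (disjoint_left.2 hC).compl_sdiff_compl_union
  have hd₁ : C₀ᶜ \ (C₀ ∪ C₁)ᶜ = C₁ := by
    rw [union_comm]
    exact (disjoint_left.2 hC).symm.compl_sdiff_compl_union
  obtain ⟨h, hh, hfh⟩ := H f (C₀ ∪ C₁)ᶜ
    (fun y hy => ⟨trivial, unitInterval.pos_iff_ne_zero.2 fun h => hy (Or.inl (h0 y h)),
      unitInterval.lt_one_iff_ne_one.2 fun h => hy (Or.inr (h1 y h))⟩)
    ⟨C₁ᶜ, C₀ᶜ, hC₁.isOpen_compl, hC₀.isOpen_compl, by rw [hd₀, hd₁, compl_compl],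
      by rw [hd₀, hd₁]; exact disjoint_left.2 hC,
      by rw [hd₀]; exact fun y hy => h0 y hy.2, by rw [hd₁]; exact fun y hy => h1 y hy.2⟩
    (hC₀.union hC₁).isOpen_compl (1 / 10) (by norm_num)
  have hclose : ∀ x, |F x - a (h x)| < 1 / 10 := hfh
  have hT : Continuous fun x => t (h x) := ht.comp h.continuous
  have hFA : ∀ x ∈ A, F x ≤ 1 / 2 := fun x hx => by
    have h1 := (hu x).1
    have h2 : w x = 0 := hw0 hx
    simp only [F]
    linarith
  have hFB : ∀ x ∈ B, 1 / 2 ≤ F x := fun x hx => by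
    have h1 := (hw x).1
    have h2 : u x = 0 := hu0 hx
    simp only [F]
    linarith
  have hzA' : t (h z) < 3 / 8 := by
    refine hA.2.isPreconnected.lt_of_forall_ne hT hpA ?_ (fun x hx hxt => ?_) hzA
    · by_contra! h'
      have h2 : u p = 1 := hu1 rfl
      have h3 : w p = 0 := hw0 hpA
      have h4 := abs_lt.1 (hclose p)
      have h5 : F p = 0 := by simp [F, h2, h3]
      exact hh p (Or.inr (Or.inl (Or.inr ⟨show a (h p) ≤ 1 / 10 by linarith, h'⟩)))
    · have h4 := abs_lt.1 (hclose x)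
      have h5 := hFA x hx
      exact hh x (Or.inr (Or.inr ⟨show a (h x) ≤ 8 / 10 by linarith, hxt⟩))
  have hzB' : -t (h z) < -(5 / 8) := by
    refine hB.2.isPreconnected.lt_of_forall_ne hT.neg hqB ?_ (fun x hx hxt => ?_) hzB
    · by_contra! h'
      have h2 : w q = 1 := hw1 rfl
      have h3 : u q = 0 := hu0 hqB
      have h4 := abs_lt.1 (hclose q)
      have h5 : F q = 1 := by simp [F, h2, h3]
      exact hh q (Or.inl (Or.inl (Or.inr
        ⟨show 9 / 10 ≤ a (h q) by linarith, neg_le_neg_iff.1 h'⟩)))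
    · have h4 := abs_lt.1 (hclose x)
      have h5 := hFB x hx
      exact hh x (Or.inl (Or.inr ⟨show 2 / 10 ≤ a (h x) by linarith, neg_injective hxt⟩))
  linarith

theorem mainTheorem4 (X : Type u) [MetricSpace X] [CompactSpace X] :
    HereditarilyIndecomposable X ↔
      ∀ (G : Type v) [MetricSpace G], IsGraph G →
        ∀ (f : C(X, G)) (M : Set (G × unitInterval)),
          M ⊆ univ ×ˢ Ioo (0 : unitInterval) 1 →
          Separates M (univ ×ˢ {(0 : unitInterval)}) (univ ×ˢ {(1 : unitInterval)}) →
          ∀ U : Set (G × unitInterval), IsOpen U → M ⊆ U →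
            ∀ ε : ℝ, 0 < ε →
              ∃ h : C(X, G × unitInterval),
                (∀ x, h x ∈ U) ∧ dist f (ContinuousMap.fst.comp h) < ε := by
  constructor
  · intro hX G _ _ f M _ hM U hU hMU ε hε
    obtain ⟨τ, hτ⟩ := hX.exists_lift f hM hU hMU
    refine ⟨f.prodMk τ, hτ, ?_⟩
    rwa [show ContinuousMap.fst.comp (f.prodMk τ) = f from rfl, dist_self]
  · intro H K hK _
    refine not_isDecomposable_of_exists_lift.{v} hK.2 fun f M hM hMs hMo ε hε => ?_
    obtain ⟨h, hh, hfh⟩ := H _ isGraph_ulift_unitInterval f M hM hMs M hMo le_rfl ε hε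
    exact ⟨h, hh, fun x => (ContinuousMap.dist_apply_le_dist x).trans_lt hfh⟩
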